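/- Let $\mathcal H,\mathcal K$ be finite-dimensional complex Hilbert spaces and let $\mathcal N:L(\mathcal H)\to L(\mathcal K)$ be a linear map that sends Hermitian operators to Hermitian operators. For $\epsilon>0$ and $t\in\mathbb R$ let $f_{\mathcal N}(\epsilon,t)\in\mathbb N\cup\{\infty\}$ be the minimum number $K$ of copies of $\rho$ for which there is a completely positive trace-preserving map $\Phi:L(\mathcal H^{\otimes K}\otimes\mathcal K)\to L(\mathcal K)$, independent of $\rho$, such that for every density operator $\rho$ on $\mathcal H$ the induced channel $\mathcal Q^\rho(\sigma)=\Phi(\rho^{\otimes K}\otimes\sigma)$ satisfies $$\big\|\mathcal Q^\rho-\big[e^{-i\mathcal N(\rho)t}\big]\big\|_\diamond\le\epsilon ,$$ where $[U](\sigma)=U\sigma U^\dagger$ and $\|\mathcal Q\|_\diamond=\sup_{\mathcal R,\,\sigma}\|(\mathcal Q\otimes\mathcal I_{\mathcal R})(\sigma)\|_1$, the supremum being over all finite-dimensional $\mathcal R$ and all density operators $\sigma$ on $\mathcal K\otimes\mathcal R$. Let $$\mathscr F=\{A\in L(\mathcal H):A^\dagger=A,\ \operatorname{Tr}A=0,\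 \|A\|_1=1,\ [\mathcal N(A^+),\mathcal N(A^-)]=0\},$$ where $A^+$ and $A^-$ are the positive and the negative part of $A=A^+-A^-$, and let $R[B]=\lambda_{\max}(B)-\lambda_{\min}(B)$ for Hermitian $B$. If $\mathscr F\neq\emptyset$, then $R_*:=\max_{A\in\mathscr F}R[\mathcal N(A)]$ exists; put $R_*:=0$ if $\mathscr F=\emptyset$. There is an absolute constant $C>0$, independent of $\mathcal H$, $\mathcal K$, $\mathcal N$, $\epsilon$ and $t$, such that whenever $0<\epsilon\le\frac16$ and $t\ge\frac{15\pi\epsilon}{4R_*}$, $$f_{\mathcal N}(\epsilon,t)\ \ge\ C\,\epsilon^{-1}R_*^2t^2 .$$ (If $R_*=0$, the quotient $\frac{15\pi\epsilon}{4R_*}$ is read as $0$, and the bound is the trivial one $f_{\mathcal N}(\epsilon,t)\ge0$.) -/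

import Mathlib

open scoped Kronecker ENNReal ComplexOrder

noncomputable section

namespace HME

variable {α β ι κ : Type*}

/-- Linear maps from `L(ℂ^α)` to `L(ℂ^β)`. -/
abbrev SuperOp (α β : Type*) := Matrix α α ℂ →ₗ[ℂ] Matrix β β ℂ

/-- The map `Q` sends Hermitian matrices to Hermitian matrices. -/
def HermitianPreserving (Q : SuperOp α β) : Prop :=
  ∀ A : Matrix α α ℂ, A.IsHermitian → (Q A).IsHermitian

/-- Density matrices. -/
def IsDensity [Fintype α] (ρ : Matrix α α ℂ) : Prop := ρ.PosSemidef ∧ ρ.trace = 1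

/-- `Q ⊗ id_r`, where `id_r` is the identity map on the reference system `L(ℂ^r)`:
`Q` is applied to each of the `r × r` blocks. -/
def ampliation (Q : SuperOp α β) (r : ℕ) : SuperOp (α × Fin r) (β × Fin r) where
  toFun X := Matrix.of fun p q => Q (Matrix.of fun a a' => X (a, p.2) (a', q.2)) p.1 q.1
  map_add' X Y := by
    ext p q
    exact congrFun (congrFun (map_add Q (Matrix.of fun a a' => X (a, p.2) (a', q.2))
      (Matrix.of fun a a' => Y (a, p.2) (a', q.2))) p.1) q.1
  map_smul' c X := by
    ext p q
    exact congrFun (congrFun (map_smul Q c (Matrix.of fun a a' => X (a, p.2) (a', q.2))) p.1) q.1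

/-- `Q ⊗ id_r` acts on product matrices as it should; this determines it. -/
theorem ampliation_kronecker (Q : SuperOp α β) (r : ℕ) (A : Matrix α α ℂ)
    (B : Matrix (Fin r) (Fin r) ℂ) : ampliation Q r (A ⊗ₖ B) = Q A ⊗ₖ B := by
  ext p q
  have h : (Matrix.of fun a a' => (A ⊗ₖ B) (a, p.2) (a', q.2)) = B p.2 q.2 • A := by
    ext a a'
    simp [Matrix.kroneckerMap_apply, mul_comm]
  change Q (Matrix.of fun a a' => (A ⊗ₖ B) (a, p.2) (a', q.2)) p.1 q.1 = Q A p.1 q.1 * B p.2 q.2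
  rw [h, map_smul, Matrix.smul_apply, smul_eq_mul, mul_comm]

variable [Fintype α] [DecidableEq α] [Fintype β] [DecidableEq β]
  [Fintype ι] [DecidableEq ι] [Fintype κ] [DecidableEq κ]

/-- Completely positive and trace-preserving maps (quantum channels). -/
structure IsCPTP (Q : SuperOp α β) : Prop where
  completelyPositive : ∀ (r : ℕ) (X : Matrix (α × Fin r) (α × Fin r) ℂ),
    X.PosSemidef → (ampliation Q r X).PosSemidef
  tracePreserving : ∀ X : Matrix α α ℂ, (Q X).trace = X.trace

/-- The trace norm: the sum of the singular values, i.e. of the square roots of the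
eigenvalues of `Aᴴ * A`. -/
def traceNorm (A : Matrix α α ℂ) : ℝ :=
  ∑ i, Real.sqrt ((Matrix.isHermitian_conjTranspose_mul_self A).eigenvalues i)

/-- The diamond norm (of a Hermitian-preserving map): the supremum of the trace norm of
`(Q ⊗ id_r) σ` over all finite dimensions `r` and all states `σ` on `ℂ^α ⊗ ℂ^r`. -/
def diamondNorm (Q : SuperOp α β) : ℝ≥0∞ :=
  ⨆ (r : ℕ) (σ : Matrix (α × Fin r) (α × Fin r) ℂ) (_ : IsDensity σ),
    ENNReal.ofReal (traceNorm (ampliation Q r σ))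

/-- `ρ^{⊗ K}` as a matrix on `(ℂ^ι)^{⊗ K}`, whose standard basis is indexed by `Fin K → ι`. -/
def tensorPower (ρ : Matrix ι ι ℂ) (K : ℕ) : Matrix (Fin K → ι) (Fin K → ι) ℂ :=
  Matrix.of fun f g => ∏ i, ρ (f i) (g i)

/-- The map `σ ↦ Φ (ρ^{⊗ K} ⊗ σ)` induced by `Φ` and `K` copies of `ρ`. -/
def inducedChannel {K : ℕ} (Φ : SuperOp ((Fin K → ι) × κ) κ) (ρ : Matrix ι ι ℂ) : SuperOp κ κ :=
  Φ ∘ₗ Matrix.kroneckerBilinear (R := ℂ) (tensorPower ρ K)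

/-- The channel `σ ↦ U σ Uᴴ`. -/
def unitaryChannel (U : Matrix κ κ ℂ) : SuperOp κ κ :=
  LinearMap.mulLeft ℂ U ∘ₗ LinearMap.mulRight ℂ U.conjTranspose

/-- The unitary `e^{-i N(ρ) t}`. -/
def evolution (N : SuperOp ι κ) (t : ℝ) (ρ : Matrix ι ι ℂ) : Matrix κ κ ℂ :=
  NormedSpace.exp ((-Complex.I * (t : ℂ)) • N ρ)

/-- Some joint channel, independent of `ρ` and of the input `σ`, realizes `e^{-i N(ρ) t}` from
`K` copies of `ρ` to accuracy `ε` in diamond distance, for every state `ρ`. -/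
def Realizable (N : SuperOp ι κ) (ε t : ℝ) (K : ℕ) : Prop :=
  ∃ Φ : SuperOp ((Fin K → ι) × κ) κ, IsCPTP Φ ∧ ∀ ρ : Matrix ι ι ℂ, IsDensity ρ →
    diamondNorm (inducedChannel Φ ρ - unitaryChannel (evolution N t ρ)) ≤ ENNReal.ofReal ε

/-- The minimum number of copies of `ρ` that suffices (`⊤` if no number does). -/
def sampleComplexity (N : SuperOp ι κ) (ε t : ℝ) : ℕ∞ :=
  ⨅ (K : ℕ) (_ : Realizable N ε t K), (K : ℕ∞)

/-- `λ_max - λ_min` of a Hermitian matrix. -/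
def spectralSpread (B : Matrix κ κ ℂ) : ℝ := sSup (spectrum ℝ B) - sInf (spectrum ℝ B)

/-- Traceless Hermitian matrices `A` of trace norm one such that the images of the positive and
the negative part of `A` commute. -/
def feasible (N : SuperOp ι κ) : Set (Matrix ι ι ℂ) :=
  {A | A.IsHermitian ∧ A.trace = 0 ∧ traceNorm A = 1 ∧ Commute (N A⁺) (N A⁻)}

/-- The largest spectral spread of `N A` over feasible `A` (`0` if there is none). -/
def maxSpread (N : SuperOp ι κ) : ℝ := sSup ((fun A => spectralSpread (N A)) '' feasible N)

end HME

end

/-!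
# A sample lower bound for Hamiltonian simulation from copies of a state

Let `A` be a feasible matrix with maximal spread `R` of `N A`, and put
`ρ_p = 2 (p A⁺ + (1 - p) A⁻)` for `0 ≤ p ≤ 1`. Two observations drive the proof.

* `N A⁺` and `N A⁻` commute, so they have common eigenvectors `v` and `w` for the largest and the
  smallest eigenvalue of `N A` (`exists_common_eigenvector`). On the superposition of `v` and `w`,
  the evolution `e^{-i N(ρ_p) t}` turns the coherence `⟨v| · |w⟩` to `z_p / 2`, where `z_p` is a
  phase with angular velocity `2 R t` in `p`.
* `K` copies of `ρ_p` are a mixture of product states over `K` Bernoulli trials with bias `p`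
  (`tensorPower_mixture`). A channel that realizes the evolution from these copies therefore
  estimates `z_p` from the trials: it assigns to the outcome `x` a coherence `f x` of modulus at
  most `1 / 2` (`norm_dotProduct_mulVec_le_half`) whose mean is within `ε` of `z_p / 2`.

Since the points `z_p / 2` lie on the boundary of the disc that contains the values `f x`, a mean
error `ε` forces most values to be close to `z_p / 2`. If two biases `p` and `q` have Bernoulli
distributions that overlap substantially, this confines the angle between `z_p` and `z_q` to
the order of `√ε` (`sum_min_mul_le`). The distributions do overlap when `|p - q|` is of the order of
`1 / √K` (`one_sub_pow_le_two_mul_sum_min`), and then the angle is of the order of `R t / √K`. Hence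
`K` is at least of the order of `R² t² / ε` (`sq_div_le_of_phase_estimation`). The lower bound on
`t` serves to exclude `K = 0`: it makes the phases `z_p` spread by more than the error `ε` allows a
channel that sees no copy of `ρ_p`.

The maximal spread is attained because the pairs `(A⁺, A⁻)` of feasible `A` are the solutions of
closed conditions in a bounded set, and the spread of `N A` is the maximum over two unit vectors
of a continuous function.
-/

namespace HME

open scoped MatrixOrder
open Matrix

/-! ### Trace norm and positive semidefinite matrices -/

section TraceNorm

variable {n : Type*} [Fintype n]

theorem inner_toLp_eq_star_dotProduct (u v : n → ℂ) :
    inner ℂ (WithLp.toLp 2 u) (WithLp.toLp 2 v) = star u ⬝ᵥ v := by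
  rw [EuclideanSpace.inner_toLp_toLp, dotProduct_comm]

theorem norm_toLp_eq_one {u : n → ℂ} (hu : star u ⬝ᵥ u = 1) :
    ‖(WithLp.toLp 2 u : EuclideanSpace ℂ n)‖ = 1 := by
  have h := inner_self_eq_norm_sq_to_K (𝕜 := ℂ) (WithLp.toLp 2 u : EuclideanSpace ℂ n)
  rw [inner_toLp_eq_star_dotProduct, hu] at h
  have h' : ‖(WithLp.toLp 2 u : EuclideanSpace ℂ n)‖ ^ 2 = 1 := Complex.ofReal_injective <| by
    rw [Complex.ofReal_pow]
    exact h.symm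
  nlinarith [norm_nonneg (WithLp.toLp 2 u : EuclideanSpace ℂ n)]

variable [DecidableEq n]

/-- Matrix elements between unit vectors are bounded by the trace norm. -/
theorem norm_dotProduct_mulVec_le_traceNorm (X : Matrix n n ℂ) {u v : n → ℂ}
    (hu : star u ⬝ᵥ u = 1) (hv : star v ⬝ᵥ v = 1) :
    ‖star u ⬝ᵥ (X *ᵥ v)‖ ≤ traceNorm X := by
  set hX := Matrix.isHermitian_conjTranspose_mul_self X
  set w := hX.eigenvectorBasis
  have hexp : star u ⬝ᵥ (X *ᵥ v) = ∑ i, inner ℂ (w i) (WithLp.toLp 2 v) *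
      inner ℂ (WithLp.toLp 2 u) (WithLp.toLp 2 (X *ᵥ ⇑(w i)) : EuclideanSpace ℂ n) := by
    have h := w.sum_repr' (WithLp.toLp 2 v)
    have h2 : v = ∑ i, inner ℂ (w i) (WithLp.toLp 2 v) • ⇑(w i) := by
      have := congrArg (WithLp.ofLp) h
      simpa using this.symm
    conv_lhs => rw [h2]
    rw [Matrix.mulVec_sum, dotProduct_sum]
    refine Finset.sum_congr rfl fun i _ => ?_
    rw [Matrix.mulVec_smul, dotProduct_smul, smul_eq_mul,
      inner_toLp_eq_star_dotProduct u]
  have hnorm : ∀ i, ‖(WithLp.toLp 2 (X *ᵥ ⇑(w i)) : EuclideanSpace ℂ n)‖ =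
      Real.sqrt (hX.eigenvalues i) := by
    intro i
    rw [@norm_eq_sqrt_re_inner ℂ]
    congr 1
    rw [inner_toLp_eq_star_dotProduct, Matrix.star_mulVec, ← Matrix.dotProduct_mulVec,
      Matrix.mulVec_mulVec, hX.mulVec_eigenvectorBasis, dotProduct_smul,
      ← inner_toLp_eq_star_dotProduct]
    simp [w]
  rw [hexp, traceNorm]
  refine (norm_sum_le _ _).trans (Finset.sum_le_sum fun i _ => ?_)
  rw [norm_mul, ← hnorm i]
  have h1 : ‖inner ℂ (w i) (WithLp.toLp 2 v : EuclideanSpace ℂ n)‖ ≤ 1 := by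
    refine (norm_inner_le_norm _ _).trans ?_
    rw [w.norm_eq_one, norm_toLp_eq_one hv, one_mul]
  have h2 : ‖inner ℂ (WithLp.toLp 2 u : EuclideanSpace ℂ n) (WithLp.toLp 2 (X *ᵥ ⇑(w i)))‖ ≤
      ‖(WithLp.toLp 2 (X *ᵥ ⇑(w i)) : EuclideanSpace ℂ n)‖ := by
    refine (norm_inner_le_norm _ _).trans ?_
    rw [norm_toLp_eq_one hu, one_mul]
  calc _ ≤ 1 * _ := mul_le_mul h1 h2 (norm_nonneg _) zero_le_one
    _ = _ := one_mul _

theorem trace_cfc {B : Matrix n n ℂ} (hB : B.IsHermitian) (f : ℝ → ℝ) :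
    (cfc f B).trace = ∑ i, (f (hB.eigenvalues i) : ℂ) := by
  rw [hB.cfc_eq, Matrix.IsHermitian.cfc, Unitary.conjStarAlgAut_apply, Matrix.trace_mul_cycle,
    Unitary.coe_star_mul_self, one_mul, Matrix.trace_diagonal]
  rfl

theorem cfc_sqrt_mul_self {S : Matrix n n ℂ} (hS : S.PosSemidef) :
    cfc Real.sqrt (S * S) = S := by
  have hsa : IsSelfAdjoint S := hS.1
  have hsq : S * S = cfc (fun x : ℝ => x * x) S := by
    rw [cfc_mul (fun x : ℝ => x) (fun x : ℝ => x) S, cfc_id' ℝ S]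
  rw [hsq, ← cfc_comp Real.sqrt (fun x : ℝ => x * x) S]
  conv_rhs => rw [← cfc_id' ℝ S]
  refine cfc_congr fun x hx => ?_
  have h0 : 0 ≤ x := spectrum_nonneg_of_nonneg (Matrix.nonneg_iff_posSemidef.2 hS) hx
  simp [Real.sqrt_mul_self h0]

/-- For orthogonal positive semidefinite `P` and `M`, the matrix `(P - M)ᴴ * (P - M)` has the square
root `P + M`. -/
theorem traceNorm_sub_eq_trace_add {P M : Matrix n n ℂ} (hP : P.PosSemidef) (hM : M.PosSemidef)
    (hPM : P * M = 0) : (traceNorm (P - M) : ℂ) = (P + M).trace := by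
  have hMP : M * P = 0 := by
    have := congrArg Matrix.conjTranspose hPM
    rwa [Matrix.conjTranspose_mul, hP.1.eq, hM.1.eq, Matrix.conjTranspose_zero] at this
  have hsq : (P - M)ᴴ * (P - M) = (P + M) * (P + M) := by
    rw [Matrix.conjTranspose_sub, hP.1.eq, hM.1.eq]
    simp [mul_sub, sub_mul, mul_add, add_mul, hPM, hMP]
  have h := trace_cfc (Matrix.isHermitian_conjTranspose_mul_self (P - M)) Real.sqrt
  rw [traceNorm, Complex.ofReal_sum, ← h, hsq, cfc_sqrt_mul_self (hP.add hM)]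

theorem re_dotProduct_mulVec_le_trace {τ : Matrix n n ℂ} (hτ : τ.PosSemidef) (u : n → ℂ) :
    (star u ⬝ᵥ (τ *ᵥ u)).re ≤ (star u ⬝ᵥ u).re * τ.trace.re := by
  have hle : τ ≤ algebraMap ℝ (Matrix n n ℂ) τ.trace.re := by
    refine le_algebraMap_of_spectrum_le (fun x hx => ?_) hτ.1
    rw [hτ.1.spectrum_real_eq_range_eigenvalues] at hx
    obtain ⟨i, rfl⟩ := hx
    rw [hτ.1.trace_eq_sum_eigenvalues]
    simpa using Finset.single_le_sum (fun j _ => hτ.eigenvalues_nonneg j) (Finset.mem_univ i)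
  have h := (Matrix.le_iff.1 hle).re_dotProduct_nonneg u
  rw [Matrix.sub_mulVec, dotProduct_sub, Algebra.algebraMap_eq_smul_one, Matrix.smul_mulVec,
    Matrix.one_mulVec, dotProduct_smul] at h
  simp at h
  linarith

/-- The coherence of a state between two orthonormal vectors is at most `1 / 2`. -/
theorem norm_dotProduct_mulVec_le_half {τ : Matrix n n ℂ} (hτ : IsDensity τ) {u v : n → ℂ}
    (hu : star u ⬝ᵥ u = 1) (hv : star v ⬝ᵥ v = 1) (huv : star u ⬝ᵥ v = 0) :
    ‖star u ⬝ᵥ (τ *ᵥ v)‖ ≤ 1 / 2 := by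
  set z := star u ⬝ᵥ (τ *ᵥ v) with hz
  have hvu : star v ⬝ᵥ u = 0 := by
    have := congrArg star huv
    rwa [← Matrix.star_dotProduct, star_zero] at this
  have hz' : star v ⬝ᵥ (τ *ᵥ u) = star z := by
    rw [hz, ← Matrix.star_dotProduct, Matrix.star_mulVec, hτ.1.1.eq, ← Matrix.dotProduct_mulVec]
  obtain ⟨c, hc, hcz⟩ : ∃ c : ℂ, ‖c‖ = 1 ∧ c * z = ‖z‖ := by
    rcases eq_or_ne z 0 with h | h
    · exact ⟨1, by simp, by simp [h]⟩
    · refine ⟨star z / ‖z‖, ?_, ?_⟩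
      · simp [h]
      · have : star z * z = (‖z‖ : ℂ) ^ 2 := Complex.conj_mul' z
        field_simp
        exact this
  have hcc : star c * c = 1 := by
    have : star c * c = (‖c‖ : ℂ) ^ 2 := Complex.conj_mul' c
    rw [this, hc]; simp
  -- Polarization: compare `u + c v` with `u - c v`.
  have hczs : star c * star z = ‖z‖ := by
    rw [← star_mul', hcz]; simp
  have e1 : star (u + c • v) ⬝ᵥ (τ *ᵥ (u + c • v)) =
      star u ⬝ᵥ (τ *ᵥ u) + star v ⬝ᵥ (τ *ᵥ v) + 2 * ‖z‖ := by
    simp only [star_add, star_smul, Matrix.mulVec_add, Matrix.mulVec_smul,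
      add_dotProduct, dotProduct_add, smul_dotProduct, dotProduct_smul, hz', ← hz, smul_eq_mul]
    linear_combination hcz + hczs + (star v ⬝ᵥ (τ *ᵥ v)) * hcc
  have e2 : star (u - c • v) ⬝ᵥ (τ *ᵥ (u - c • v)) =
      star u ⬝ᵥ (τ *ᵥ u) + star v ⬝ᵥ (τ *ᵥ v) - 2 * ‖z‖ := by
    simp only [star_sub, star_smul, Matrix.mulVec_sub, Matrix.mulVec_smul,
      sub_dotProduct, dotProduct_sub, smul_dotProduct, dotProduct_smul, hz', ← hz, smul_eq_mul]
    linear_combination - hcz - hczs + (star v ⬝ᵥ (τ *ᵥ v)) * hcc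
  have e3 : star (u + c • v) ⬝ᵥ (u + c • v) = 2 := by
    simp only [star_add, star_smul, add_dotProduct, dotProduct_add, smul_dotProduct,
      dotProduct_smul, hu, hv, huv, hvu, smul_eq_mul]
    linear_combination hcc
  have h1 := re_dotProduct_mulVec_le_trace hτ.1 (u + c • v)
  have h2 := hτ.1.re_dotProduct_nonneg (u - c • v)
  rw [e1, e3, hτ.2] at h1
  rw [e2] at h2
  simp at h1 h2
  linarith

end TraceNorm

/-! ### The maximal spectral spread is attained -/

section Spectrum

variable {n : Type*} [Fintype n]

theorem exists_unit_eigenvector [DecidableEq n] {B : Matrix n n ℂ} (hB : B.IsHermitian) {x : ℝ}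
    (hx : x ∈ spectrum ℝ B) : ∃ v : n → ℂ, star v ⬝ᵥ v = 1 ∧ B *ᵥ v = (x : ℂ) • v := by
  rw [hB.spectrum_real_eq_range_eigenvalues] at hx
  obtain ⟨i, rfl⟩ := hx
  refine ⟨hB.eigenvectorBasis i, ?_, ?_⟩
  · rw [← inner_toLp_eq_star_dotProduct]
    simp
  · rw [hB.mulVec_eigenvectorBasis]
    rfl

theorem spectrum_nonempty [DecidableEq n] [Nonempty n] {B : Matrix n n ℂ} (hB : B.IsHermitian) :
    (spectrum ℝ B).Nonempty :=
  hB.spectrum_real_eq_range_eigenvalues ▸ Set.range_nonempty _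

theorem re_dotProduct_mulVec_le_sSup [DecidableEq n] {B : Matrix n n ℂ} (hB : B.IsHermitian)
    {u : n → ℂ} (hu : star u ⬝ᵥ u = 1) : (star u ⬝ᵥ (B *ᵥ u)).re ≤ sSup (spectrum ℝ B) := by
  have hle : B ≤ algebraMap ℝ (Matrix n n ℂ) (sSup (spectrum ℝ B)) :=
    le_algebraMap_of_spectrum_le (fun x hx => le_csSup finite_real_spectrum.bddAbove hx) hB
  have h := (Matrix.le_iff.1 hle).re_dotProduct_nonneg u
  rw [Matrix.sub_mulVec, dotProduct_sub, Algebra.algebraMap_eq_smul_one, Matrix.smul_mulVec,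
    Matrix.one_mulVec, dotProduct_smul, hu] at h
  simpa using h

theorem sInf_le_re_dotProduct_mulVec [DecidableEq n] {B : Matrix n n ℂ} (hB : B.IsHermitian)
    {u : n → ℂ} (hu : star u ⬝ᵥ u = 1) : sInf (spectrum ℝ B) ≤ (star u ⬝ᵥ (B *ᵥ u)).re := by
  have hle : algebraMap ℝ (Matrix n n ℂ) (sInf (spectrum ℝ B)) ≤ B :=
    algebraMap_le_of_le_spectrum (fun x hx => csInf_le finite_real_spectrum.bddBelow hx) hB
  have h := (Matrix.le_iff.1 hle).re_dotProduct_nonneg u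
  rw [Matrix.sub_mulVec, dotProduct_sub, Algebra.algebraMap_eq_smul_one, Matrix.smul_mulVec,
    Matrix.one_mulVec, dotProduct_smul, hu] at h
  simpa using h

theorem spectralSpread_nonneg [DecidableEq n] {B : Matrix n n ℂ} (hB : B.IsHermitian) :
    0 ≤ spectralSpread B := by
  rcases isEmpty_or_nonempty n with h | h
  · have : Subsingleton (Matrix n n ℂ) := inferInstance
    simp [spectralSpread]
  · rw [spectralSpread, sub_nonneg]
    exact csInf_le_csSup (spectrum_nonempty hB) finite_real_spectrum.bddBelow
      finite_real_spectrum.bddAbove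

/-- If `B` and `D` commute, then each eigenvalue of `B - D` is attained on a common eigenvector of
`B` and `D`: the eigenspace of `B - D` is invariant under `B`. -/
theorem exists_common_eigenvector [DecidableEq n] {B D : Matrix n n ℂ}
    (hB : B.IsHermitian) (hD : D.IsHermitian) (hBD : Commute B D) {x : ℝ}
    (hx : x ∈ spectrum ℝ (B - D)) :
    ∃ (v : n → ℂ) (b d : ℝ), star v ⬝ᵥ v = 1 ∧ B *ᵥ v = (b : ℂ) • v ∧ D *ᵥ v = (d : ℂ) • v ∧
      b - d = x := by
  obtain ⟨w, hw1, hw⟩ := exists_unit_eigenvector (hB.sub hD) hx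
  have hw0 : w ≠ 0 := by rintro rfl; simp at hw1
  set E := Module.End.eigenspace (Matrix.toLin' (B - D)) (x : ℂ)
  have hE : ∀ v, v ∈ E ↔ (B - D) *ᵥ v = (x : ℂ) • v := fun v => by
    rw [Module.End.mem_eigenspace_iff, Matrix.toLin'_apply]
  have hcomm : B * (B - D) = (B - D) * B := by rw [mul_sub, sub_mul, hBD.eq]
  have hinv : ∀ v ∈ E, Matrix.toLin' B v ∈ E := fun v hv => by
    rw [hE] at hv ⊢
    rw [Matrix.toLin'_apply, Matrix.mulVec_mulVec, ← hcomm, ← Matrix.mulVec_mulVec, hv,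
      Matrix.mulVec_smul]
  have : Nontrivial E := ⟨⟨⟨w, (hE w).2 hw⟩, 0, fun h => hw0 (congrArg Subtype.val h)⟩⟩
  obtain ⟨c, hc⟩ := Module.End.exists_eigenvalue ((Matrix.toLin' B).restrict hinv)
  obtain ⟨v₀, hv₀⟩ := hc.exists_hasEigenvector
  have hv₀B : B *ᵥ (v₀ : n → ℂ) = c • (v₀ : n → ℂ) := by
    have := congrArg Subtype.val hv₀.apply_eq_smul
    simpa [Matrix.toLin'_apply] using this
  have hv₀0 : (v₀ : n → ℂ) ≠ 0 := fun h => hv₀.2 (Subtype.ext h)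
  have hv₀E := (hE _).1 v₀.2
  have hpos : 0 < ‖(WithLp.toLp 2 (v₀ : n → ℂ) : EuclideanSpace ℂ n)‖ :=
    norm_pos_iff.2 fun h => hv₀0 (by simpa using h)
  set r := ‖(WithLp.toLp 2 (v₀ : n → ℂ) : EuclideanSpace ℂ n)‖ with hr
  have hself : star (v₀ : n → ℂ) ⬝ᵥ (v₀ : n → ℂ) = (r : ℂ) ^ 2 := by
    rw [← inner_toLp_eq_star_dotProduct, inner_self_eq_norm_sq_to_K, ← hr]
    rfl
  have hcv : star (v₀ : n → ℂ) ⬝ᵥ (B *ᵥ (v₀ : n → ℂ)) = c * (r : ℂ) ^ 2 := by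
    rw [hv₀B, dotProduct_smul, hself, smul_eq_mul]
  have him : c.im = 0 := by
    have h := hB.im_star_dotProduct_mulVec_self (v₀ : n → ℂ)
    rw [hcv, ← Complex.ofReal_pow, RCLike.im_to_complex, Complex.im_mul_ofReal] at h
    exact (mul_eq_zero.1 h).resolve_right (pow_pos hpos 2).ne'
  have hcre : ((c.re : ℝ) : ℂ) = c := by
    apply Complex.ext <;> simp [him]
  refine ⟨((r : ℂ)⁻¹) • (v₀ : n → ℂ), c.re, c.re - x, ?_, ?_, ?_, by ring⟩
  · have : (r : ℂ) ≠ 0 := by exact_mod_cast hpos.ne'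
    rw [star_smul, smul_dotProduct, dotProduct_smul, hself]
    simp
    field_simp
  · rw [Matrix.mulVec_smul, hv₀B, hcre, smul_comm]
  · have : D *ᵥ (v₀ : n → ℂ) = (c - x) • (v₀ : n → ℂ) := by
      rw [sub_smul, ← hv₀B, ← hv₀E, Matrix.sub_mulVec]
      abel
    rw [Matrix.mulVec_smul, this, Complex.ofReal_sub, hcre, smul_comm]

theorem dotProduct_eq_zero_of_eigenvalues_ne {B : Matrix n n ℂ} (hB : B.IsHermitian) {u v : n → ℂ}
    {x y : ℝ} (hu : B *ᵥ u = (x : ℂ) • u) (hv : B *ᵥ v = (y : ℂ) • v) (hxy : x ≠ y) :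
    star u ⬝ᵥ v = 0 := by
  have h1 : star u ⬝ᵥ (B *ᵥ v) = y * (star u ⬝ᵥ v) := by rw [hv, dotProduct_smul, smul_eq_mul]
  have h2 : star u ⬝ᵥ (B *ᵥ v) = x * (star u ⬝ᵥ v) := by
    rw [Matrix.dotProduct_mulVec, ← hB.eq, ← Matrix.star_mulVec, hu, star_smul, smul_dotProduct]
    simp
  have h3 : ((x : ℂ) - y) * (star u ⬝ᵥ v) = 0 := by linear_combination h1 - h2
  refine (mul_eq_zero.1 h3).resolve_left fun h => hxy ?_
  exact_mod_cast sub_eq_zero.1 h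

end Spectrum

section Compactness

variable {ι κ : Type*} [Fintype ι] [DecidableEq ι] [Fintype κ]

/-- Pairs of orthogonal positive semidefinite matrices of trace `1/2` whose images under `N`
commute: the pairs `(A⁺, A⁻)` for feasible `A`. -/
def feasiblePairs (N : SuperOp ι κ) : Set (Matrix ι ι ℂ × Matrix ι ι ℂ) :=
  {p | p.1.PosSemidef ∧ p.2.PosSemidef ∧ p.1 * p.2 = 0 ∧ p.1.trace = 1 / 2 ∧ p.2.trace = 1 / 2 ∧
    N p.1 * N p.2 = N p.2 * N p.1}

theorem posPart_negPart_mem_feasiblePairs {N : SuperOp ι κ} {A : Matrix ι ι ℂ}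
    (hA : A ∈ feasible N) : (A⁺, A⁻) ∈ feasiblePairs N := by
  obtain ⟨hH, htr, hnorm, hcomm⟩ := hA
  have hP : (A⁺).PosSemidef := nonneg_iff_posSemidef.1 (CFC.posPart_nonneg A)
  have hM : (A⁻).PosSemidef := nonneg_iff_posSemidef.1 (CFC.negPart_nonneg A)
  have hsub : A⁺ - A⁻ = A := CFC.posPart_sub_negPart A hH
  have hmul : A⁺ * A⁻ = 0 := CFC.posPart_mul_negPart A
  have h1 := traceNorm_sub_eq_trace_add hP hM hmul
  rw [hsub, hnorm, Matrix.trace_add] at h1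
  have h2 := congrArg Matrix.trace hsub
  rw [htr, Matrix.trace_sub] at h2
  push_cast at h1
  refine ⟨hP, hM, hmul, ?_, ?_, hcomm.eq⟩
  · linear_combination (h2 - h1) / 2
  · linear_combination (-h2 - h1) / 2

theorem sub_mem_feasible {N : SuperOp ι κ} {p : Matrix ι ι ℂ × Matrix ι ι ℂ}
    (hp : p ∈ feasiblePairs N) : p.1 - p.2 ∈ feasible N := by
  obtain ⟨hP, hM, hmul, htP, htM, hcomm⟩ := hp
  obtain ⟨e1, e2⟩ := CFC.posPart_negPart_unique (a := p.1 - p.2) rfl hmul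
    (nonneg_iff_posSemidef.2 hP) (nonneg_iff_posSemidef.2 hM)
  refine ⟨hP.1.sub hM.1, ?_, ?_, ?_⟩
  · rw [Matrix.trace_sub, htP, htM, sub_self]
  · have h := traceNorm_sub_eq_trace_add hP hM hmul
    rw [Matrix.trace_add, htP, htM] at h
    norm_num at h
    exact h
  · rw [e1, e2]
    exact hcomm

theorem norm_apply_le_trace {P : Matrix ι ι ℂ} (hP : P.PosSemidef) (i j : ι) :
    (‖P i j‖ : ℂ) ≤ P.trace := by
  have h := traceNorm_sub_eq_trace_add hP PosSemidef.zero (mul_zero P)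
  rw [sub_zero, add_zero] at h
  rw [← h]
  have h1 := norm_dotProduct_mulVec_le_traceNorm P (u := Pi.single i 1) (v := Pi.single j 1)
    (by simp) (by simp)
  rw [Pi.star_single, star_one, single_one_dotProduct, mulVec_single_one] at h1
  exact_mod_cast h1

theorem isClosed_posSemidef {n : Type*} [Fintype n] :
    IsClosed {P : Matrix n n ℂ | P.PosSemidef} := by
  simp only [Matrix.posSemidef_iff_dotProduct_mulVec, Set.ofPred_and, Set.ofPred_forall]
  refine IsClosed.inter ?_ (isClosed_iInter fun x => ?_)
  · exact isClosed_eq continuous_id.matrix_conjTranspose continuous_id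
  · exact isClosed_le continuous_const
      (continuous_const.dotProduct (continuous_id.matrix_mulVec continuous_const))

theorem isCompact_feasiblePairs (N : SuperOp ι κ) : IsCompact (feasiblePairs N) := by
  have hN : Continuous N := LinearMap.continuous_of_finiteDimensional N
  have hbox : IsCompact {P : Matrix ι ι ℂ | ∀ i j, ‖P i j‖ ≤ 1 / 2} := by
    have h : {P : ι → ι → ℂ | ∀ i j, ‖P i j‖ ≤ 1 / 2} = Set.univ.pi fun _ : ι =>
        Set.univ.pi fun _ : ι => Metric.closedBall (0 : ℂ) (1 / 2) := by
      ext P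
      simp [Set.mem_pi]
    change IsCompact {P : ι → ι → ℂ | ∀ i j, ‖P i j‖ ≤ 1 / 2}
    rw [h]
    exact isCompact_univ_pi fun _ => isCompact_univ_pi fun _ => isCompact_closedBall _ _
  have hmem : ∀ P : Matrix ι ι ℂ, P.PosSemidef → P.trace = 1 / 2 → ∀ i j, ‖P i j‖ ≤ 1 / 2 := by
    intro P hP ht i j
    have := norm_apply_le_trace hP i j
    rw [ht] at this
    have h2 : ((‖P i j‖ : ℝ) : ℂ) ≤ ((1 / 2 : ℝ) : ℂ) := by push_cast; exact this
    exact_mod_cast h2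
  refine (hbox.prod hbox).of_isClosed_subset ?_ ?_
  · refine IsClosed.inter (isClosed_posSemidef.preimage continuous_fst) <|
      IsClosed.inter (isClosed_posSemidef.preimage continuous_snd) <|
      IsClosed.inter (isClosed_eq (continuous_fst.mul continuous_snd) continuous_const) <|
      IsClosed.inter (isClosed_eq continuous_fst.matrix_trace continuous_const) <|
      IsClosed.inter (isClosed_eq continuous_snd.matrix_trace continuous_const) <|
      isClosed_eq ?_ ?_
    · exact (hN.comp continuous_fst).mul (hN.comp continuous_snd)
    · exact (hN.comp continuous_snd).mul (hN.comp continuous_fst)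
  · rintro ⟨P, M⟩ ⟨hP, hM, -, htP, htM, -⟩
    exact ⟨hmem P hP htP, hmem M hM htM⟩

theorem isCompact_unit_vectors : IsCompact {u : κ → ℂ | star u ⬝ᵥ u = 1} := by
  have hbox : IsCompact (Set.univ.pi fun _ : κ => Metric.closedBall (0 : ℂ) 1) :=
    isCompact_univ_pi fun _ => isCompact_closedBall _ _
  refine hbox.of_isClosed_subset
    (isClosed_eq (continuous_star.dotProduct continuous_id) continuous_const) fun u hu i _ => ?_
  have h := PiLp.norm_apply_le (WithLp.toLp 2 u : EuclideanSpace ℂ κ) i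
  rw [norm_toLp_eq_one hu] at h
  simpa using h

/-- The spread of `N A` is the maximum of a continuous function of `A` and two unit vectors, so
compactness provides a feasible `A` with maximal spread. -/
theorem exists_isGreatest_spectralSpread [DecidableEq κ] {N : SuperOp ι κ}
    (hN : HermitianPreserving N) (hne : (feasible N).Nonempty) :
    ∃ m, IsGreatest ((fun A => spectralSpread (N A)) '' feasible N) m := by
  obtain ⟨A₀, hA₀⟩ := hne
  rcases isEmpty_or_nonempty κ with hκ | hκ
  · refine ⟨spectralSpread (N A₀), ⟨A₀, hA₀, rfl⟩, ?_⟩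
    rintro _ ⟨A, -, rfl⟩
    exact le_of_eq (congrArg spectralSpread (Subsingleton.elim _ _))
  have hNc : Continuous N := LinearMap.continuous_of_finiteDimensional N
  set S : Set (κ → ℂ) := {u | star u ⬝ᵥ u = 1}
  have hS : IsCompact S := isCompact_unit_vectors
  have hSne : S.Nonempty := ⟨Pi.single (Classical.arbitrary κ) 1, by simp [S]⟩
  let g : (Matrix ι ι ℂ × Matrix ι ι ℂ) × (κ → ℂ) × (κ → ℂ) → ℝ := fun p =>
    (star p.2.1 ⬝ᵥ (N (p.1.1 - p.1.2) *ᵥ p.2.1)).re -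
      (star p.2.2 ⬝ᵥ (N (p.1.1 - p.1.2) *ᵥ p.2.2)).re
  have hg : Continuous g := by
    have hA : Continuous fun p : (Matrix ι ι ℂ × Matrix ι ι ℂ) × (κ → ℂ) × (κ → ℂ) =>
        N (p.1.1 - p.1.2) := hNc.comp (by fun_prop)
    have h1 : Continuous fun p : (Matrix ι ι ℂ × Matrix ι ι ℂ) × (κ → ℂ) × (κ → ℂ) => p.2.1 := by
      fun_prop
    have h2 : Continuous fun p : (Matrix ι ι ℂ × Matrix ι ι ℂ) × (κ → ℂ) × (κ → ℂ) => p.2.2 := by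
      fun_prop
    exact (Complex.continuous_re.comp (h1.star.dotProduct (hA.matrix_mulVec h1))).sub
      (Complex.continuous_re.comp (h2.star.dotProduct (hA.matrix_mulVec h2)))
  obtain ⟨⟨p, u, v⟩, ⟨hp, hu, hv⟩, hmax⟩ :=
    ((isCompact_feasiblePairs N).prod (hS.prod hS)).exists_isMaxOn
      (Set.Nonempty.prod ⟨_, posPart_negPart_mem_feasiblePairs hA₀⟩ (hSne.prod hSne))
      hg.continuousOn
  refine ⟨spectralSpread (N (p.1 - p.2)), ⟨_, sub_mem_feasible hp, rfl⟩, ?_⟩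
  rintro _ ⟨A, hA, rfl⟩
  have hNA := hN A hA.1
  obtain ⟨x, hx1, hx⟩ := exists_unit_eigenvector hNA
    ((spectrum_nonempty hNA).csSup_mem finite_real_spectrum)
  obtain ⟨y, hy1, hy⟩ := exists_unit_eigenvector hNA
    ((spectrum_nonempty hNA).csInf_mem finite_real_spectrum)
  have hle : g ((A⁺, A⁻), x, y) ≤ g (p, u, v) :=
    hmax ⟨posPart_negPart_mem_feasiblePairs hA, hx1, hy1⟩
  have hsub : A⁺ - A⁻ = A := CFC.posPart_sub_negPart A hA.1
  have hgA : g ((A⁺, A⁻), x, y) = spectralSpread (N A) := by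
    simp only [g, hsub, hx, hy, dotProduct_smul, hx1, hy1]
    simp [spectralSpread]
  have hB := hN _ (sub_mem_feasible hp).1
  have h1 := re_dotProduct_mulVec_le_sSup hB hu
  have h2 := sInf_le_re_dotProduct_mulVec hB hv
  rw [hgA] at hle
  refine hle.trans ?_
  simp only [g, spectralSpread]
  linarith

end Compactness

/-! ### Estimating a phase from Bernoulli samples -/

/-- Two distributions `P`, `Q` that both predict the average of the same bounded function `f`,
up to error `ε`, as different points `z / 2`, `z' / 2` on the circle of radius `1 / 2`, have little
overlap. A single value of `f` cannot be close to both points, so the common part of `P` and `Q`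
pays for their separation. -/
theorem sum_min_mul_le {X : Type*} [Fintype X] {P Q : X → ℝ} (hP0 : ∀ x, 0 ≤ P x)
    (hQ0 : ∀ x, 0 ≤ Q x) (hP : ∑ x, P x = 1) (hQ : ∑ x, Q x = 1) {f : X → ℂ}
    (hf : ∀ x, ‖f x‖ ≤ 1 / 2) {z z' : ℂ} (hz : ‖z‖ = 1) (hz' : ‖z'‖ = 1) {ε : ℝ}
    (hPf : ‖∑ x, (P x : ℂ) * f x - z / 2‖ ≤ ε) (hQf : ‖∑ x, (Q x : ℂ) * f x - z' / 2‖ ≤ ε) :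
    (∑ x, min (P x) (Q x)) * (2 - ‖z + z'‖) ≤ 4 * ε := by
  -- The loss of `x` with respect to `z` is `1 - 2 Re (conj z * f x)`.
  have hloss : ∀ {P : X → ℝ} {z : ℂ}, ∑ x, P x = 1 → ‖z‖ = 1 →
      ‖∑ x, (P x : ℂ) * f x - z / 2‖ ≤ ε →
      ∑ x, P x * (1 - 2 * (star z * f x).re) ≤ 2 * ε := by
    intro P z hP hz hPf
    have h1 : ∑ x, P x * (1 - 2 * (star z * f x).re) =
        -2 * (star z * (∑ x, (P x : ℂ) * f x - z / 2)).re := by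
      have hzz : star z * z = 1 := by
        have : star z * z = (‖z‖ : ℂ) ^ 2 := Complex.conj_mul' z
        rw [this, hz]; simp
      have h2 : star z * (∑ x, (P x : ℂ) * f x - z / 2) =
          ∑ x, ((P x : ℝ) : ℂ) * (star z * f x) - ((1 / 2 : ℝ) : ℂ) := by
        rw [mul_sub, Finset.mul_sum]
        congr 1
        · exact Finset.sum_congr rfl fun x _ => by ring
        · push_cast
          linear_combination hzz / 2
      rw [h2, Complex.sub_re, Complex.re_sum, Complex.ofReal_re]
      simp only [Complex.re_ofReal_mul, mul_sub, Finset.sum_sub_distrib, mul_one, hP,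
        mul_left_comm _ (2 : ℝ), ← Finset.mul_sum]
      ring
    have h3 := (Complex.abs_re_le_norm (star z * (∑ x, (P x : ℂ) * f x - z / 2)))
    rw [norm_mul, norm_star, hz, one_mul] at h3
    rw [h1]
    linarith [(abs_le.1 (h3.trans hPf)).1]
  have hnonneg : ∀ {z : ℂ}, ‖z‖ = 1 → ∀ x, 0 ≤ 1 - 2 * (star z * f x).re := by
    intro z hz x
    have h := Complex.re_le_norm (star z * f x)
    rw [norm_mul, norm_star, hz, one_mul] at h
    linarith [hf x]
  have hpoint : ∀ x, min (P x) (Q x) * (2 - ‖z + z'‖) ≤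
      P x * (1 - 2 * (star z * f x).re) + Q x * (1 - 2 * (star z' * f x).re) := by
    intro x
    have h := Complex.re_le_norm (star (z + z') * f x)
    rw [norm_mul, norm_star, star_add, add_mul, Complex.add_re] at h
    have h2 : ‖z + z'‖ * ‖f x‖ ≤ ‖z + z'‖ * (1 / 2) :=
      mul_le_mul_of_nonneg_left (hf x) (norm_nonneg _)
    have h3 : min (P x) (Q x) * (2 - ‖z + z'‖) ≤ min (P x) (Q x) *
        ((1 - 2 * (star z * f x).re) + (1 - 2 * (star z' * f x).re)) :=
      mul_le_mul_of_nonneg_left (by linarith) (le_min (hP0 x) (hQ0 x))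
    have h4 := mul_le_mul_of_nonneg_right (min_le_left (P x) (Q x)) (hnonneg hz x)
    have h5 := mul_le_mul_of_nonneg_right (min_le_right (P x) (Q x)) (hnonneg hz' x)
    linarith
  rw [Finset.sum_mul]
  refine (Finset.sum_le_sum fun x _ => hpoint x).trans ?_
  rw [Finset.sum_add_distrib]
  linarith [hloss hP hz hPf, hloss hQ hz' hQf]

/-- The probability of the outcome `x` of `K` independent Bernoulli trials with success
probability `p`. -/
def bernoulliWeight {K : ℕ} (p : ℝ) (x : Fin K → Bool) : ℝ := ∏ i, bif x i then p else 1 - p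

theorem bernoulliWeight_nonneg {K : ℕ} {p : ℝ} (h0 : 0 ≤ p) (h1 : p ≤ 1) (x : Fin K → Bool) :
    0 ≤ bernoulliWeight p x :=
  Finset.prod_nonneg fun i _ => by cases x i <;> simp [h0, h1]

theorem sum_bernoulliWeight (K : ℕ) (p : ℝ) : ∑ x : Fin K → Bool, bernoulliWeight p x = 1 := by
  have h := Finset.prod_univ_sum (fun _ : Fin K => (Finset.univ : Finset Bool))
    (fun _ b => bif b then p else 1 - p)
  rw [Fintype.piFinset_univ] at h
  simp only [bernoulliWeight, ← h]
  simp

/-- The overlap of two Bernoulli samples, bounded through their Bhattacharyya coefficient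
`(1 - 4 δ ^ 2) ^ (K / 2)`. -/
theorem one_sub_pow_le_two_mul_sum_min (K : ℕ) {δ : ℝ} (h0 : 0 ≤ δ) (h1 : δ ≤ 1 / 2) :
    (1 - 4 * δ ^ 2) ^ K ≤
      2 * ∑ x : Fin K → Bool,
        min (bernoulliWeight (1 / 2 + δ) x) (bernoulliWeight (1 / 2 - δ) x) := by
  set P := fun x : Fin K → Bool => bernoulliWeight (1 / 2 + δ) x with hP
  set Q := fun x : Fin K → Bool => bernoulliWeight (1 / 2 - δ) x with hQ
  have hP0 : ∀ x, 0 ≤ P x := bernoulliWeight_nonneg (by linarith) (by linarith)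
  have hQ0 : ∀ x, 0 ≤ Q x := bernoulliWeight_nonneg (by linarith) (by linarith)
  have hs : (0 : ℝ) ≤ 1 / 4 - δ ^ 2 := by nlinarith
  have hPQ : ∀ x, P x * Q x = (1 / 4 - δ ^ 2) ^ K := by
    intro x
    rw [hP, hQ]
    simp only [bernoulliWeight, ← Finset.prod_mul_distrib]
    rw [Finset.prod_congr rfl (g := fun _ => 1 / 4 - δ ^ 2) fun i _ => by
      cases x i <;> simp <;> ring]
    simp
  have hcs := Finset.sum_sq_le_sum_mul_sum_of_sq_le_mul (Finset.univ : Finset (Fin K → Bool))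
    (r := fun _ => Real.sqrt ((1 / 4 - δ ^ 2) ^ K)) (f := fun x => min (P x) (Q x))
    (g := fun x => max (P x) (Q x)) (fun x _ => le_min (hP0 x) (hQ0 x))
    (fun x _ => (hP0 x).trans (le_max_left _ _))
    (fun x _ => by rw [Real.sq_sqrt (pow_nonneg hs K), min_mul_max, hPQ])
  have hmax : ∑ x, max (P x) (Q x) ≤ 2 := by
    calc ∑ x, max (P x) (Q x) ≤ ∑ x, (P x + Q x) := Finset.sum_le_sum fun x _ =>
          max_le (by linarith [hQ0 x]) (by linarith [hP0 x])
      _ = 2 := by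
          rw [Finset.sum_add_distrib, sum_bernoulliWeight, sum_bernoulliWeight]
          norm_num
  have hmin : 0 ≤ ∑ x, min (P x) (Q x) :=
    Finset.sum_nonneg fun x _ => le_min (hP0 x) (hQ0 x)
  have hlhs : (∑ _x : Fin K → Bool, Real.sqrt ((1 / 4 - δ ^ 2) ^ K)) ^ 2 = (1 - 4 * δ ^ 2) ^ K := by
    rw [Finset.sum_const, nsmul_eq_mul, mul_pow, Real.sq_sqrt (pow_nonneg hs K)]
    simp only [Finset.card_univ, Fintype.card_pi, Fintype.card_bool, Finset.prod_const,
      Fintype.card_fin]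
    push_cast
    rw [← pow_mul, mul_comm K 2, pow_mul, ← mul_pow]
    congr 1
    ring
  rw [hlhs] at hcs
  nlinarith [mul_le_mul_of_nonneg_left hmax hmin]

theorem norm_exp_add_exp (α β : ℝ) :
    ‖Complex.exp (α * Complex.I) + Complex.exp (β * Complex.I)‖ = 2 * |Real.cos ((α - β) / 2)| := by
  have h : Complex.exp (α * Complex.I) + Complex.exp (β * Complex.I) =
      Complex.exp (((α + β) / 2 : ℝ) * Complex.I) * ((2 * Real.cos ((α - β) / 2) : ℝ) : ℂ) := by
    push_cast
    rw [Complex.two_cos, mul_add, ← Complex.exp_add, ← Complex.exp_add]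
    congr 2 <;> ring
  rw [h, norm_mul, Complex.norm_exp_ofReal_mul_I, one_mul, Complex.norm_real, Real.norm_eq_abs,
    abs_mul, abs_two]

theorem norm_exp_sub_exp (α β : ℝ) :
    ‖Complex.exp (α * Complex.I) - Complex.exp (β * Complex.I)‖ = 2 * |Real.sin ((α - β) / 2)| := by
  have h := norm_exp_add_exp α (β + Real.pi)
  have h1 : Complex.exp ((β + Real.pi : ℝ) * Complex.I) = -Complex.exp (β * Complex.I) := by
    push_cast
    rw [add_mul, Complex.exp_add, Complex.exp_pi_mul_I, mul_neg_one]
  have h2 : (α - (β + Real.pi)) / 2 = (α - β) / 2 - Real.pi / 2 := by ring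
  rwa [h1, ← sub_eq_add_neg, h2, Real.cos_sub_pi_div_two] at h

/-- `arccos (1 - y)` is of the order of `√y`: this is `sin (x / 2) ≥ x / π` at `x = arccos (1 - y)`,
together with `π ^ 2 ≤ 10`. -/
theorem arccos_one_sub_sq_le {y : ℝ} (h0 : 0 ≤ y) (h1 : y ≤ 1) :
    Real.arccos (1 - y) ^ 2 ≤ 5 * y := by
  set x := Real.arccos (1 - y)
  have hx0 : 0 ≤ x := Real.arccos_nonneg _
  have hxpi : x ≤ Real.pi := Real.arccos_le_pi _
  have hcos : Real.cos x = 1 - y := Real.cos_arccos (by linarith) (by linarith)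
  have hsin := Real.mul_le_sin (x := x / 2) (by linarith) (by linarith)
  have hc : Real.cos x = 1 - 2 * Real.sin (x / 2) ^ 2 := by
    have h := Real.cos_two_mul (x / 2)
    rw [mul_div_cancel₀ x two_ne_zero] at h
    linarith [Real.sin_sq_add_cos_sq (x / 2)]
  have hpi := Real.pi_pos
  have h2 : 2 / Real.pi * (x / 2) = x / Real.pi := by ring
  rw [h2] at hsin
  have h3 : (x / Real.pi) ^ 2 ≤ Real.sin (x / 2) ^ 2 :=
    pow_le_pow_left₀ (by positivity) hsin 2
  have h4 : x ^ 2 = (x / Real.pi) ^ 2 * Real.pi ^ 2 := by field_simp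
  have h5 : Real.pi ^ 2 ≤ 10 := by nlinarith [Real.pi_lt_d2]
  have h6 : (x / Real.pi) ^ 2 ≤ y / 2 := by linarith
  rw [h4]
  nlinarith [sq_nonneg (x / Real.pi)]

/-- If `K` Bernoulli samples of unknown bias `p` determine, in the mean and up to error `ε`, a phase
with angular velocity `2 T` in `p`, then `K` is of order `T ^ 2 / ε` at least. -/
theorem sq_div_le_of_phase_estimation {K : ℕ} {f : (Fin K → Bool) → ℂ} (hf : ∀ x, ‖f x‖ ≤ 1 / 2)
    {ε T φ : ℝ} (hε : 0 < ε) (hε' : ε ≤ 1 / 6) (hT : 15 * Real.pi * ε / 4 ≤ T)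
    (h : ∀ p : ℝ, 0 ≤ p → p ≤ 1 →
      ‖∑ x, (bernoulliWeight p x : ℂ) * f x -
        Complex.exp ((φ - 2 * p * T : ℝ) * Complex.I) / 2‖ ≤ ε) :
    T ^ 2 / (250 * ε) ≤ K := by
  have hpi := Real.pi_pos
  have hT0 : 0 < T := lt_of_lt_of_le (by positivity) hT
  rcases Nat.eq_zero_or_pos K with rfl | hK
  · -- Without samples the estimate does not depend on `p`.
    exfalso
    obtain ⟨y, hy0, hypi, hyT, hsin⟩ : ∃ y : ℝ, 0 ≤ y ∧ y ≤ Real.pi / 2 ∧ y ≤ T ∧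
        2 * ε < Real.sin y := by
      rcases le_total T (Real.pi / 2) with hle | hle
      · refine ⟨T, hT0.le, hle, le_rfl, ?_⟩
        have h1 := Real.mul_le_sin hT0.le hle
        have h2 : 2 / Real.pi * (15 * Real.pi * ε / 4) ≤ 2 / Real.pi * T :=
          mul_le_mul_of_nonneg_left hT (by positivity)
        have h3 : 2 / Real.pi * (15 * Real.pi * ε / 4) = 15 / 2 * ε := by field_simp; norm_num
        linarith
      · exact ⟨Real.pi / 2, by positivity, le_rfl, hle, by rw [Real.sin_pi_div_two]; linarith⟩
    have h0 := h 0 le_rfl zero_le_one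
    have h1 := h (y / T) (by positivity) (by rw [div_le_one hT0]; exact hyT)
    have hw : ∀ p : ℝ, ∑ x : Fin 0 → Bool, (bernoulliWeight p x : ℂ) * f x = f default := by
      intro p
      rw [Fintype.sum_unique]
      simp only [bernoulliWeight, Finset.univ_eq_empty, Finset.prod_empty,
        Complex.ofReal_one, one_mul]
      exact congrArg f (Subsingleton.elim _ _)
    rw [hw] at h0 h1
    have h2 := norm_exp_sub_exp (φ - 2 * 0 * T) (φ - 2 * (y / T) * T)
    have h3 : (φ - 2 * 0 * T - (φ - 2 * (y / T) * T)) / 2 = y := by field_simp; ring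
    rw [h3, abs_of_nonneg (Real.sin_nonneg_of_nonneg_of_le_pi hy0 (by linarith))] at h2
    set a := Complex.exp ((φ - 2 * 0 * T : ℝ) * Complex.I)
    set b := Complex.exp ((φ - 2 * (y / T) * T : ℝ) * Complex.I)
    have h4 : (a - b) / 2 = (f default - b / 2) - (f default - a / 2) := by ring
    have h5 : ‖(a - b) / 2‖ ≤ ε + ε := h4 ▸ (norm_sub_le _ _).trans (add_le_add h1 h0)
    rw [norm_div, h2] at h5
    norm_num at h5
    linarith
  · by_contra! hlt
    have hK1 : (1 : ℝ) ≤ K := by exact_mod_cast hK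
    -- The biases `1 / 2 ± δ` give phases at angle `2 x`, where `cos x = 1 - 5 ε`: their sum has
    -- modulus `2 - 10 ε`, so that an overlap above `2 / 5` contradicts `sum_min_mul_le`.
    set x := Real.arccos (1 - 5 * ε) with hx
    have hcos : Real.cos x = 1 - 5 * ε := Real.cos_arccos (by linarith) (by linarith)
    have hxsq : x ^ 2 ≤ 5 * (5 * ε) := arccos_one_sub_sq_le (by linarith) (by linarith)
    have hx0 : 0 ≤ x := Real.arccos_nonneg _
    set δ := x / (2 * T) with hδ
    have hδ0 : 0 ≤ δ := by positivity
    have hδT : 2 * δ * T = x := by rw [hδ]; field_simp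
    have hKε : K * (250 * ε) < T ^ 2 := by rwa [lt_div_iff₀ (by positivity)] at hlt
    have hKδ : 4 * K * δ ^ 2 < 1 / 10 := by
      have h1 : 4 * K * δ ^ 2 = K * x ^ 2 / T ^ 2 := by
        rw [hδ]
        field_simp
        ring
      rw [h1, div_lt_iff₀ (by positivity)]
      nlinarith [mul_le_mul_of_nonneg_left hxsq (by linarith : (0 : ℝ) ≤ K)]
    have hδ2 : 4 * δ ^ 2 < 1 / 10 := by nlinarith [sq_nonneg δ]
    have hδ1 : δ ≤ 1 / 2 := by nlinarith
    have hbern := one_add_mul_le_pow (a := -(4 * δ ^ 2)) (by linarith) K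
    rw [← sub_eq_add_neg] at hbern
    have hover := one_sub_pow_le_two_mul_sum_min K hδ0 hδ1
    have hmain := sum_min_mul_le
      (bernoulliWeight_nonneg (p := 1 / 2 + δ) (by linarith) (by linarith))
      (bernoulliWeight_nonneg (p := 1 / 2 - δ) (by linarith) (by linarith))
      (sum_bernoulliWeight K _) (sum_bernoulliWeight K _) hf
      (Complex.norm_exp_ofReal_mul_I _) (Complex.norm_exp_ofReal_mul_I _)
      (h (1 / 2 + δ) (by linarith) (by linarith)) (h (1 / 2 - δ) (by linarith) (by linarith))
    have h3 : (φ - 2 * (1 / 2 + δ) * T - (φ - 2 * (1 / 2 - δ) * T)) / 2 = -x := by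
      linear_combination -hδT
    rw [norm_exp_add_exp, h3, Real.cos_neg, hcos, abs_of_nonneg (by linarith)] at hmain
    nlinarith

/-! ### Channels acting on mixtures of product states -/

section Channels

variable {α β : Type*} [Fintype α] [Fintype β]

theorem mulVec_exp_of_eigenvector [DecidableEq α] {A : Matrix α α ℂ} {v : α → ℂ} {a : ℂ}
    (h : A *ᵥ v = a • v) :
    NormedSpace.exp A *ᵥ v = Complex.exp a • v := by
  open scoped Matrix.Norms.Operator in
  have hpow : ∀ k : ℕ, A ^ k *ᵥ v = a ^ k • v := by
    intro k
    induction k with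
    | zero => simp
    | succ k ih => rw [pow_succ, ← Matrix.mulVec_mulVec, h, Matrix.mulVec_smul, ih, smul_smul,
        pow_succ']
  have h1 : HasSum (fun k : ℕ => ((k.factorial : ℂ)⁻¹ • A ^ k) *ᵥ v) (NormedSpace.exp A *ᵥ v) :=
    (NormedSpace.exp_series_hasSum_exp' (𝕂 := ℂ) A).map (Matrix.mulVec.addMonoidHomLeft v)
      (continuous_id.matrix_mulVec continuous_const)
  have h2 : HasSum (fun k : ℕ => ((k.factorial : ℂ)⁻¹ • a ^ k) • v) (Complex.exp a • v) := by
    rw [Complex.exp_eq_exp_ℂ]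
    exact (NormedSpace.exp_series_hasSum_exp' (𝕂 := ℂ) a).smul_const v
  refine h1.unique ?_
  convert h2 using 2 with k
  rw [Matrix.smul_mulVec, hpow, smul_assoc]

theorem IsDensity.kronecker {ρ : Matrix α α ℂ} {σ : Matrix β β ℂ} (hρ : IsDensity ρ)
    (hσ : IsDensity σ) : IsDensity (ρ ⊗ₖ σ) :=
  ⟨hρ.1.kronecker hσ.1, by rw [Matrix.trace_kronecker, hρ.2, hσ.2, one_mul]⟩

theorem isDensity_one : IsDensity (1 : Matrix (Fin 1) (Fin 1) ℂ) := ⟨PosSemidef.one, by simp⟩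

theorem IsCPTP.isDensity [DecidableEq α] {Q : SuperOp α β} (hQ : IsCPTP Q)
    {ρ : Matrix α α ℂ} (hρ : IsDensity ρ) : IsDensity (Q ρ) := by
  refine ⟨?_, (hQ.tracePreserving ρ).trans hρ.2⟩
  have h := hQ.completelyPositive 1 _ (hρ.kronecker isDensity_one).1
  rw [ampliation_kronecker] at h
  have h2 := h.submatrix (fun b : β => (b, (0 : Fin 1)))
  convert h2 using 1
  ext i j
  simp

/-- Matrix entries of the output are controlled by the diamond norm: use a trivial reference
system. -/
theorem norm_dotProduct_mulVec_le_of_diamondNorm_le [DecidableEq β] {Q : SuperOp α β} {ε : ℝ}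
    (hε : 0 ≤ ε) (hQ : diamondNorm Q ≤ ENNReal.ofReal ε) {σ : Matrix α α ℂ} (hσ : IsDensity σ)
    {u v : β → ℂ} (hu : star u ⬝ᵥ u = 1) (hv : star v ⬝ᵥ v = 1) : ‖star u ⬝ᵥ (Q σ *ᵥ v)‖ ≤ ε := by
  have h1 : ENNReal.ofReal (traceNorm (ampliation Q 1 (σ ⊗ₖ (1 : Matrix (Fin 1) (Fin 1) ℂ)))) ≤
      ENNReal.ofReal ε := by
    refine le_trans ?_ hQ
    refine le_trans ?_ (le_iSup _ 1)
    refine le_trans ?_ (le_iSup _ (σ ⊗ₖ (1 : Matrix (Fin 1) (Fin 1) ℂ)))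
    exact le_iSup_of_le (hσ.kronecker isDensity_one) le_rfl
  rw [ENNReal.ofReal_le_ofReal_iff hε, ampliation_kronecker] at h1
  have hlift : ∀ w : β → ℂ, star w ⬝ᵥ w = 1 →
      star (fun p : β × Fin 1 => w p.1) ⬝ᵥ (fun p : β × Fin 1 => w p.1) = 1 := by
    intro w hw
    rw [← hw]
    simp [dotProduct, Fintype.sum_prod_type]
  have h2 := norm_dotProduct_mulVec_le_traceNorm (Q σ ⊗ₖ (1 : Matrix (Fin 1) (Fin 1) ℂ))
    (hlift u hu) (hlift v hv)
  have h3 : star (fun p : β × Fin 1 => u p.1) ⬝ᵥ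
      ((Q σ ⊗ₖ (1 : Matrix (Fin 1) (Fin 1) ℂ)) *ᵥ fun p : β × Fin 1 => v p.1) =
      star u ⬝ᵥ (Q σ *ᵥ v) := by
    simp [dotProduct, Matrix.mulVec, Fintype.sum_prod_type]
  rw [h3] at h2
  exact h2.trans h1

end Channels

section ProductStates

variable {ι : Type*} {K : ℕ}

/-- The product matrix `⨂ i, ρ i`, with the index convention of `tensorPower`. -/
def productMatrix (ρ : Fin K → Matrix ι ι ℂ) : Matrix (Fin K → ι) (Fin K → ι) ℂ :=
  Matrix.of fun f g => ∏ i, ρ i (f i) (g i)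

/-- `K` copies of a mixture are a Bernoulli mixture of product states. -/
theorem tensorPower_mixture (ρ σ : Matrix ι ι ℂ) (p : ℝ) (K : ℕ) :
    tensorPower ((p : ℂ) • ρ + ((1 - p : ℝ) : ℂ) • σ) K =
      ∑ x : Fin K → Bool, (bernoulliWeight p x : ℂ) •
        productMatrix fun i => bif x i then ρ else σ := by
  ext f g
  have h := Finset.prod_univ_sum (fun _ : Fin K => (Finset.univ : Finset Bool))
    (fun i b => ((bif b then p else 1 - p : ℝ) : ℂ) * (bif b then ρ else σ) (f i) (g i))
  rw [Fintype.piFinset_univ] at h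
  rw [Matrix.sum_apply]
  simp only [tensorPower, productMatrix, bernoulliWeight, Matrix.of_apply, Matrix.smul_apply,
    smul_eq_mul, Complex.ofReal_prod, ← Finset.prod_mul_distrib]
  rw [← h]
  simp

variable [Fintype ι]

theorem posSemidef_productMatrix [DecidableEq ι] {ρ : Fin K → Matrix ι ι ℂ}
    (hρ : ∀ i, (ρ i).PosSemidef) : (productMatrix ρ).PosSemidef := by
  choose B hB using fun i =>
    CStarAlgebra.nonneg_iff_eq_star_mul_self.1 (nonneg_iff_posSemidef.2 (hρ i))
  have h : productMatrix ρ = (productMatrix B)ᴴ * productMatrix B := by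
    ext f g
    have h1 := Finset.prod_univ_sum (fun _ : Fin K => (Finset.univ : Finset ι))
      (fun i k => star (B i k (f i)) * B i k (g i))
    rw [Fintype.piFinset_univ] at h1
    rw [Matrix.mul_apply]
    simp only [productMatrix, Matrix.of_apply, Matrix.conjTranspose_apply, star_prod,
      ← Finset.prod_mul_distrib]
    rw [← h1]
    refine Finset.prod_congr rfl fun i _ => ?_
    conv_lhs => rw [hB i]
    rw [Matrix.mul_apply]
    rfl
  rw [h]
  exact posSemidef_conjTranspose_mul_self _

theorem trace_productMatrix (ρ : Fin K → Matrix ι ι ℂ) :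
    (productMatrix ρ).trace = ∏ i, (ρ i).trace := by
  classical
  have h1 := Finset.prod_univ_sum (fun _ : Fin K => (Finset.univ : Finset ι))
    (fun i k => ρ i k k)
  rw [Fintype.piFinset_univ] at h1
  exact h1.symm

theorem isDensity_productMatrix [DecidableEq ι] {ρ : Fin K → Matrix ι ι ℂ}
    (hρ : ∀ i, IsDensity (ρ i)) : IsDensity (productMatrix ρ) :=
  ⟨posSemidef_productMatrix fun i => (hρ i).1, by
    rw [trace_productMatrix]; exact Finset.prod_eq_one fun i _ => (hρ i).2⟩

theorem IsDensity.mixture {ρ σ : Matrix ι ι ℂ} (hρ : IsDensity ρ) (hσ : IsDensity σ) {p : ℝ}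
    (h0 : 0 ≤ p) (h1 : p ≤ 1) : IsDensity ((p : ℂ) • ρ + ((1 - p : ℝ) : ℂ) • σ) := by
  refine ⟨(hρ.1.smul (by exact_mod_cast h0)).add
    (hσ.1.smul (by exact_mod_cast sub_nonneg.2 h1)), ?_⟩
  rw [Matrix.trace_add, Matrix.trace_smul, Matrix.trace_smul, hρ.2, hσ.2]
  simp

end ProductStates

/-! ### The lower bound -/

section LowerBound

variable {ι κ : Type*}

theorem inducedChannel_mixture {K : ℕ} (Φ : SuperOp ((Fin K → ι) × κ) κ) (ρ σ : Matrix ι ι ℂ)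
    (p : ℝ) (s : Matrix κ κ ℂ) :
    inducedChannel Φ ((p : ℂ) • ρ + ((1 - p : ℝ) : ℂ) • σ) s =
      ∑ x : Fin K → Bool, (bernoulliWeight p x : ℂ) •
        Φ (productMatrix (fun i => bif x i then ρ else σ) ⊗ₖ s) := by
  rw [inducedChannel, LinearMap.comp_apply, tensorPower_mixture, map_sum, LinearMap.sum_apply,
    map_sum]
  refine Finset.sum_congr rfl fun x _ => ?_
  rw [map_smul, LinearMap.smul_apply, map_smul]
  rfl

variable [Fintype ι] [DecidableEq ι] [Fintype κ]

/-- The pure state `(v + w) / √2` as a rank-one matrix: the equal superposition of `v` and `w`. -/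
noncomputable def superposition (v w : κ → ℂ) : Matrix κ κ ℂ :=
  (1 / 2 : ℂ) • vecMulVec (v + w) (star (v + w))

theorem isDensity_superposition {v w : κ → ℂ} (hv : star v ⬝ᵥ v = 1) (hw : star w ⬝ᵥ w = 1)
    (hvw : star v ⬝ᵥ w = 0) : IsDensity (superposition v w) := by
  have hwv : star w ⬝ᵥ v = 0 := by
    have := congrArg star hvw
    rwa [← Matrix.star_dotProduct, star_zero] at this
  refine ⟨(posSemidef_vecMulVec_self_star _).smul (by positivity), ?_⟩
  rw [superposition, Matrix.trace_smul, Matrix.trace_vecMulVec, dotProduct_comm]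
  simp only [star_add, add_dotProduct, dotProduct_add, hv, hw, hvw, hwv, smul_eq_mul]
  norm_num

/-- A unitary with eigenvectors `v` and `w` turns the coherence between them by the difference of
the two phases. -/
theorem dotProduct_unitaryChannel_superposition [DecidableEq κ] {U : Matrix κ κ ℂ}
    {v w : κ → ℂ} {a b : ℝ} (hv : star v ⬝ᵥ v = 1) (hw : star w ⬝ᵥ w = 1) (hvw : star v ⬝ᵥ w = 0)
    (hUv : U *ᵥ v = Complex.exp (a * Complex.I) • v)
    (hUw : U *ᵥ w = Complex.exp (b * Complex.I) • w) :
    star v ⬝ᵥ (unitaryChannel U (superposition v w) *ᵥ w) =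
      Complex.exp ((a - b : ℝ) * Complex.I) / 2 := by
  have hwv : star w ⬝ᵥ v = 0 := by
    have := congrArg star hvw
    rwa [← Matrix.star_dotProduct, star_zero] at this
  have h1 : unitaryChannel U (superposition v w) =
      (1 / 2 : ℂ) • vecMulVec (U *ᵥ (v + w)) (star (U *ᵥ (v + w))) := by
    rw [unitaryChannel, LinearMap.comp_apply, LinearMap.mulLeft_apply, LinearMap.mulRight_apply,
      superposition, Matrix.smul_mul, Matrix.mul_smul, Matrix.vecMulVec_mul, Matrix.mul_vecMulVec,
      Matrix.star_mulVec]
  have h2 : star (U *ᵥ (v + w)) ⬝ᵥ w = Complex.exp ((-b : ℝ) * Complex.I) := by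
    rw [Matrix.mulVec_add, hUv, hUw, star_add, star_smul, star_smul, add_dotProduct,
      smul_dotProduct, smul_dotProduct, hvw, hw]
    simp [← Complex.exp_conj]
  have h3 : star v ⬝ᵥ (U *ᵥ (v + w)) = Complex.exp (a * Complex.I) := by
    rw [Matrix.mulVec_add, hUv, hUw, dotProduct_add, dotProduct_smul, dotProduct_smul, hv, hvw]
    simp
  rw [h1, Matrix.smul_mulVec, Matrix.vecMulVec_mulVec, h2, dotProduct_smul]
  simp only [dotProduct_smul, h3, smul_eq_mul, MulOpposite.smul_eq_mul_unop, MulOpposite.unop_op]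
  rw [← Complex.exp_add, sub_eq_add_neg a b, Complex.ofReal_add, add_mul,
    add_comm ((a : ℂ) * Complex.I)]
  ring

variable [DecidableEq κ]

/-- The core estimate: a channel that realizes the evolution for the states
`2 (p A⁺ + (1 - p) A⁻)` estimates the phase between two common eigenvectors of `N A⁺` and `N A⁻`
from `K` Bernoulli samples. -/
theorem sq_div_le_of_realizable {N : SuperOp ι κ} (hN : HermitianPreserving N) {A : Matrix ι ι ℂ}
    (hA : A ∈ feasible N) {ε t : ℝ} (hε : 0 < ε) (hε' : ε ≤ 1 / 6)
    (hR : 0 < spectralSpread (N A)) (ht : 15 * Real.pi * ε / 4 ≤ spectralSpread (N A) * t) {K : ℕ}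
    (hK : Realizable N ε t K) : (spectralSpread (N A) * t) ^ 2 / (250 * ε) ≤ K := by
  have hκ : Nonempty κ := by
    by_contra h
    rw [not_nonempty_iff] at h
    have : Subsingleton (Matrix κ κ ℂ) := inferInstance
    simp [spectralSpread] at hR
  obtain ⟨hP, hM, -, htP, htM, hcomm⟩ := posPart_negPart_mem_feasiblePairs hA
  have hsub : A⁺ - A⁻ = A := CFC.posPart_sub_negPart A hA.1
  dsimp only at hP hM htP htM hcomm
  set P := A⁺
  set M := A⁻
  have hNA : N A = N P - N M := by rw [← hsub, map_sub]
  have hdens : ∀ {P : Matrix ι ι ℂ}, P.PosSemidef → P.trace = 1 / 2 → IsDensity ((2 : ℂ) • P) :=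
    fun hP htP => ⟨hP.smul (by positivity), by rw [Matrix.trace_smul, htP]; norm_num⟩
  have hρ := hdens hP htP
  have hσ := hdens hM htM
  have hNH := hN A hA.1
  have hmax := (spectrum_nonempty hNH).csSup_mem finite_real_spectrum
  have hmin := (spectrum_nonempty hNH).csInf_mem finite_real_spectrum
  have hne : sSup (spectrum ℝ (N A)) ≠ sInf (spectrum ℝ (N A)) := (sub_pos.1 hR).ne'
  rw [hNA] at hmax hmin
  obtain ⟨v, b, d, hv, hPv, hMv, hbd⟩ :=
    exists_common_eigenvector (hN P hP.1) (hN M hM.1) hcomm hmax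
  obtain ⟨w, b', d', hw, hPw, hMw, hbd'⟩ :=
    exists_common_eigenvector (hN P hP.1) (hN M hM.1) hcomm hmin
  rw [← hNA] at hbd hbd'
  have heig : ∀ {v : κ → ℂ} {b d : ℝ}, N P *ᵥ v = (b : ℂ) • v → N M *ᵥ v = (d : ℂ) • v →
      N A *ᵥ v = ((b - d : ℝ) : ℂ) • v := by
    intro v b d h1 h2
    rw [hNA, Matrix.sub_mulVec, h1, h2, ← sub_smul, Complex.ofReal_sub]
  have hvw : star v ⬝ᵥ w = 0 :=
    dotProduct_eq_zero_of_eigenvalues_ne hNH (heig hPv hMv) (heig hPw hMw) (by rwa [hbd, hbd'])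
  obtain ⟨Φ, hΦ, hreal⟩ := hK
  have hs := isDensity_superposition hv hw hvw
  refine sq_div_le_of_phase_estimation (φ := -2 * t * (d - d'))
    (f := fun x => star v ⬝ᵥ
      (Φ (productMatrix (fun i => bif x i then (2 : ℂ) • P else (2 : ℂ) • M) ⊗ₖ
        superposition v w) *ᵥ w))
    (fun x => ?_) hε hε' ht fun p hp0 hp1 => ?_
  · refine norm_dotProduct_mulVec_le_half (hΦ.isDensity (IsDensity.kronecker
      (isDensity_productMatrix fun i => ?_) hs)) hv hw hvw
    cases x i
    exacts [hσ, hρ]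
  have hmix := hρ.mixture hσ hp0 hp1
  have hentry := norm_dotProduct_mulVec_le_of_diamondNorm_le hε.le (hreal _ hmix) hs hv hw
  -- The phases of `v` and `w` are affine in `p`.
  have hU : ∀ {v : κ → ℂ} {b d : ℝ}, N P *ᵥ v = (b : ℂ) • v → N M *ᵥ v = (d : ℂ) • v →
      evolution N t ((p : ℂ) • (2 : ℂ) • P + ((1 - p : ℝ) : ℂ) • (2 : ℂ) • M) *ᵥ v =
        Complex.exp ((-(2 * t * (p * b + (1 - p) * d)) : ℝ) * Complex.I) • v := by
    intro v b d h1 h2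
    refine mulVec_exp_of_eigenvector ?_
    rw [map_add, map_smul, map_smul, map_smul, map_smul, Matrix.smul_mulVec, Matrix.add_mulVec]
    simp only [Matrix.smul_mulVec, h1, h2, smul_smul, ← add_smul]
    congr 1
    push_cast
    ring
  rw [LinearMap.sub_apply, Matrix.sub_mulVec, dotProduct_sub, inducedChannel_mixture,
    dotProduct_unitaryChannel_superposition hv hw hvw (hU hPv hMv) (hU hPw hMw)] at hentry
  convert hentry using 3
  · rw [Matrix.sum_mulVec, dotProduct_sum]
    exact Finset.sum_congr rfl fun x _ => by
      rw [Matrix.smul_mulVec, dotProduct_smul, smul_eq_mul]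
  · congr 4
    rw [spectralSpread, ← hbd, ← hbd']
    ring

end LowerBound

end HME

theorem theorem4 :
    ∃ C : ℝ, 0 < C ∧
      ∀ (ι κ : Type) [Fintype ι] [DecidableEq ι] [Fintype κ] [DecidableEq κ]
        (N : HME.SuperOp ι κ), HME.HermitianPreserving N →
        ((HME.feasible N).Nonempty →
          IsGreatest ((fun A => HME.spectralSpread (N A)) '' HME.feasible N) (HME.maxSpread N)) ∧
        ∀ ε t : ℝ, 0 < ε → ε ≤ 1 / 6 → 15 * Real.pi * ε / (4 * HME.maxSpread N) ≤ t →
          ENNReal.ofReal (C * (ε⁻¹ * HME.maxSpread N ^ 2 * t ^ 2)) ≤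
            (HME.sampleComplexity N ε t : ℝ≥0∞) := by
  refine ⟨1 / 250, by norm_num, fun ι κ _ _ _ _ N hN => ?_⟩
  have hgreatest : (HME.feasible N).Nonempty →
      IsGreatest ((fun A => HME.spectralSpread (N A)) '' HME.feasible N) (HME.maxSpread N) := by
    intro hne
    obtain ⟨m, hm⟩ := HME.exists_isGreatest_spectralSpread hN hne
    rw [HME.maxSpread, hm.csSup_eq]
    exact hm
  refine ⟨hgreatest, fun ε t hε hε' ht => ?_⟩
  rcases eq_or_ne (HME.maxSpread N) 0 with h0 | h0
  · simp [h0]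
  have hne : (HME.feasible N).Nonempty := by
    -- The supremum over the empty set is `0`.
    by_contra h
    rw [Set.not_nonempty_iff_eq_empty] at h
    simp [HME.maxSpread, h] at h0
  obtain ⟨A, hA, hAR⟩ := (hgreatest hne).1
  dsimp only at hAR
  have hR : 0 < HME.spectralSpread (N A) :=
    lt_of_le_of_ne (HME.spectralSpread_nonneg (hN A hA.1)) (by rw [hAR]; exact h0.symm)
  rw [← hAR] at ht ⊢
  have ht' : 15 * Real.pi * ε / 4 ≤ HME.spectralSpread (N A) * t := by
    rw [div_le_iff₀ (by positivity)] at ht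
    linarith
  have hreal : ∀ K : ℕ, HME.Realizable N ε t K →
      1 / 250 * (ε⁻¹ * HME.spectralSpread (N A) ^ 2 * t ^ 2) ≤ K := by
    intro K hK
    refine le_of_eq_of_le ?_ (HME.sq_div_le_of_realizable hN hA hε hε' hR ht' hK)
    field_simp
  have hceil : ((⌈1 / 250 * (ε⁻¹ * HME.spectralSpread (N A) ^ 2 * t ^ 2)⌉₊ : ℕ) : ℕ∞) ≤
      HME.sampleComplexity N ε t :=
    le_iInf₂ fun K hK => by exact_mod_cast Nat.ceil_le.2 (hreal K hK)
  refine le_trans ?_ (ENat.toENNReal_le.2 hceil)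
  rw [ENat.toENNReal_coe, ← ENNReal.ofReal_natCast]
  exact ENNReal.ofReal_le_ofReal (Nat.le_ceil _)
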